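/- Let $d\ge 1$ and let $\mathcal T\in\mathbb R^{n_1\times\cdots\times n_d}$ be a nonzero tensor of multilinear rank $\mathbf r=(r_1,\dots,r_d)$, that is, $\operatorname{rank}\mathscr M_i(\mathcal T)=r_i$ for every $i$, where $\mathscr M_i$ is the mode-$i$ matricization. Let $\|\cdot\|_F$ be the Frobenius norm and let $\kappa_1=\sigma_1(\mathscr M_1(\mathcal T))/\sigma_{r_1}(\mathscr M_1(\mathcal T))$, with $\sigma_i$ the $i$-th largest singular value. Let $\mathscr A:\mathbb R^{n_1\times\cdots\times n_d}\to\mathbb R^m$ be a linear operator, with adjoint $\mathscr A^*$, that has the first-mode restricted isometry property with rank $3r_1$ and constant $R_{3r_1}$: $$(1-R_{3r_1})\|\mathcal Z\|_F^2\le\|\mathscr A(\mathcal Z)\|_2^2\le(1+R_{3r_1})\|\mathcal Z\|_F^2\quad\text{for all }\mathcal Z\text{ with }\operatorname{rank}\mathscr M_1(\mathcal Z)\le 3r_1 .$$ The sequentially truncated HOSVD $\mathscr H^{\mathrm{ST}}_{\mathbf r}(\mathcal Z)$ is computed as follows. Put $\mathcal B=\mathcal Z$; for $i=1,\dots,d$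 take a truncated-$r_i$ SVD $\mathbf U_i,\mathbf\Sigma_i,\mathbf V_i$ of $\mathscr M_i(\mathcal B)$ (the $r_i$ leading terms of a singular value decomposition) and replace $\mathcal B$ by $\mathscr M_i^{-1}(\mathbf\Sigma_i\mathbf V_i^T)$; the output is $\mathcal B\times_1\mathbf U_1\times_2\cdots\times_d\mathbf U_d$. The SM-QRGD algorithm with constant step size $1$ starts from $\mathcal W^0=\mathscr A^*\mathscr A(\mathcal T)$ and computes, for $k=0,1,2,\dots$, $\mathcal X^k=\mathscr H^{\mathrm{ST}}_{\mathbf r}(\mathcal W^k)$ (so that $\mathcal X^0=\mathscr H^{\mathrm{ST}}_{\mathbf r}(\mathscr A^*\mathscr A(\mathcal T))$) and $$\mathcal W^{k+1}=\mathscr M_1^{-1}\Big(\mathscr P_k\big(\mathscr M_1\big(\mathcal X^k+\mathscr A^*\mathscr A(\mathcal T-\mathcal X^k)\big)\big)\Big),\qquad \mathscr P_k(\mathbf Y)=\mathbf U\mathbf U^T\mathbf Y+\mathbf Y\mathbf V\mathbf V^T-\mathbf U\mathbf U^T\mathbf Y\mathbf V\mathbf V^T,$$ where $\mathbf U,\mathbf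 V$ hold the left and right singular vectors of the truncated-$r_1$ SVD of $\mathscr M_1(\mathcal W^k)$ that was used in the first step of $\mathscr H^{\mathrm{ST}}_{\mathbf r}(\mathcal W^k)$; that is, they are the singular matrices of $\mathscr M_1(\hat{\mathcal X}^k)$ for the first-mode truncation $\hat{\mathcal X}^k=\mathscr M_1^{-1}(\mathbf U\mathbf\Sigma\mathbf V^T)$ of $\mathcal W^k$. Define $$\gamma_1:=R_{3r_1}\Big(8\sqrt{r_1}\,\kappa_1\big((\sqrt{d-1}+1)(R_{3r_1}+2)+R_{3r_1}\big)+\sqrt d+3\Big).$$ **Theorem.** (i) If $$R_{3r_1}<\min\Big(\tfrac12,\ \frac1{(20\sqrt{d-1}+24)\sqrt{r_1}\,\kappa_1+\sqrt d+3}\Big),$$ then $\gamma_1<1$. (ii) If $\gamma_1<1$, then, whatever choices are made in the singular value decompositions, the iterates of SM-QRGD with constant step size $1$ satisfy, for all $k\ge 0$, $$\|\mathcal X^{k+1}-\mathcal T\|_F\le(\sqrt d+1)\Big(\tfrac52\sqrt{d-1}+3\Big)\gamma_1^k\,\|\mathcal T\|_F .$$ In particular, under the condition in (i) the iterates converge linearly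 to $\mathcal T$. -/

import Mathlib

namespace SMQRGD

/-- Real tensors of order `d` and size `n 0 × ⋯ × n (d - 1)` (modes are numbered from `0`), with the
entrywise inner product and the induced (Frobenius) norm. -/
abbrev Tensor {d : ℕ} (n : Fin d → ℕ) : Type :=
  EuclideanSpace ℝ (∀ j, Fin (n j))

/-- Column indices of the mode-`k` matricization: one index for every mode other than `k`. -/
abbrev RestIdx {d : ℕ} (n : Fin d → ℕ) (k : Fin d) : Type :=
  ∀ j : {j : Fin d // j ≠ k}, Fin (n j)

/-- A tensor index is the index in mode `k` together with the indices in the other modes. -/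
def splitIdx {d : ℕ} (n : Fin d → ℕ) (k : Fin d) :
    (∀ j, Fin (n j)) ≃ Fin (n k) × RestIdx n k :=
  Equiv.piSplitAt k (fun j => Fin (n j))

/-- The same for tensors whose dimension in mode `k` has been changed to `p`. -/
def splitIdxUpdate {d : ℕ} (n : Fin d → ℕ) (k : Fin d) (p : ℕ) :
    (∀ j, Fin (Function.update n k p j)) ≃ Fin p × RestIdx n k :=
  (splitIdx (Function.update n k p) k).trans
    (Equiv.prodCongr (finCongr (Function.update_self k p n))
      (Equiv.piCongrRight fun j => finCongr (Function.update_of_ne j.2 p n)))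

/-- Mode-`k` matricization `M_k(X)`. -/
def unfold {d : ℕ} {n : Fin d → ℕ} (k : Fin d) (X : Tensor n) :
    Matrix (Fin (n k)) (RestIdx n k) ℝ :=
  Matrix.of fun a b => X ((splitIdx n k).symm (a, b))

/-- The inverse `M_k⁻¹` of the mode-`k` matricization. -/
def fold {d : ℕ} {n : Fin d → ℕ} (k : Fin d) (M : Matrix (Fin (n k)) (RestIdx n k) ℝ) :
    Tensor n :=
  WithLp.toLp 2 fun i => M (splitIdx n k i).1 (splitIdx n k i).2

/-- Mode-`k` matricization of a tensor whose dimension in mode `k` is `p` and whose other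
dimensions are those of `n`. -/
def unfoldUpdate {d : ℕ} {n : Fin d → ℕ} (k : Fin d) {p : ℕ}
    (Y : Tensor (Function.update n k p)) : Matrix (Fin p) (RestIdx n k) ℝ :=
  Matrix.of fun a b => Y ((splitIdxUpdate n k p).symm (a, b))

/-- The inverse of `unfoldUpdate`. -/
def foldUpdate {d : ℕ} {n : Fin d → ℕ} (k : Fin d) {p : ℕ}
    (M : Matrix (Fin p) (RestIdx n k) ℝ) : Tensor (Function.update n k p) :=
  WithLp.toLp 2 fun i => M (splitIdxUpdate n k p i).1 (splitIdxUpdate n k p i).2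

/-- The mode-`k` product `Y ×_k U`, that is, `M_k(Y ×_k U) = U * M_k(Y)`, for `Y` of dimension `p`
in mode `k` and `U` of size `n k × p`. -/
def modeProduct {d : ℕ} {n : Fin d → ℕ} (k : Fin d) {p : ℕ}
    (Y : Tensor (Function.update n k p)) (U : Matrix (Fin (n k)) (Fin p) ℝ) : Tensor n :=
  fold k (U * unfoldUpdate k Y)

/-- `X` has multilinear rank `r`: the mode-`k` matricization has rank `r k` for every `k`. -/
def HasMultilinearRank {d : ℕ} {n : Fin d → ℕ} (X : Tensor n) (r : Fin d → ℕ) : Prop :=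
  ∀ k, (unfold k X).rank = r k

/-- `M = U Σ Vᵀ` is a singular value decomposition with `p` terms: `U` and `V` have orthonormal
columns, and the singular values are nonnegative and in decreasing order. -/
structure IsSVD {a b : Type*} [Fintype a] [Fintype b] (M : Matrix a b ℝ) {p : ℕ}
    (U : Matrix a (Fin p) ℝ) (σ : Fin p → ℝ) (V : Matrix b (Fin p) ℝ) : Prop where
  left_orthonormal : U.transpose * U = 1
  right_orthonormal : V.transpose * V = 1
  antitone : Antitone σ
  nonneg : ∀ i, 0 ≤ σ i
  eq : M = U * Matrix.diagonal σ * V.transpose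

/-- `U, σ, V` is a truncated-`ρ` SVD of `M`: the first `ρ` terms of a singular value decomposition
of `M`. -/
def IsTruncatedSVD {a b : Type*} [Fintype a] [Fintype b] (M : Matrix a b ℝ) {ρ : ℕ}
    (U : Matrix a (Fin ρ) ℝ) (σ : Fin ρ → ℝ) (V : Matrix b (Fin ρ) ℝ) : Prop :=
  ∃ (p : ℕ) (h : ρ ≤ p) (U' : Matrix a (Fin p) ℝ) (σ' : Fin p → ℝ) (V' : Matrix b (Fin p) ℝ),
    IsSVD M U' σ' V' ∧ U = U'.submatrix id (Fin.castLE h) ∧ σ = σ' ∘ Fin.castLE h ∧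
      V = V'.submatrix id (Fin.castLE h)

/-- One truncation step of ST-HOSVD, in mode `k`. The triple `U, σ, V` is a truncated SVD of
`M_k(Z)`, the remaining modes are processed (relation `P`) on the smaller tensor
`B = M_k⁻¹(Σ Vᵀ)`, with result `Y`, and the output is `X = Y ×_k U`. -/
def IsTruncationStep {d : ℕ} {n : Fin d → ℕ} (k : Fin d) {ρ : ℕ}
    (P : Tensor (Function.update n k ρ) → Tensor (Function.update n k ρ) → Prop) (Z : Tensor n)
    (U : Matrix (Fin (n k)) (Fin ρ) ℝ) (σ : Fin ρ → ℝ) (V : Matrix (RestIdx n k) (Fin ρ) ℝ)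
    (X : Tensor n) : Prop :=
  IsTruncatedSVD (unfold k Z) U σ V ∧
    ∃ Y, P (foldUpdate k (Matrix.diagonal σ * V.transpose)) Y ∧ X = modeProduct k Y U

/-- `X` is an output of the sequentially truncated HOSVD of `Z`, with truncation ranks `r`, run over
the modes in the list in the given order. -/
def IsSTHOSVD {d : ℕ} (r : Fin d → ℕ) :
    List (Fin d) → ∀ n : Fin d → ℕ, Tensor n → Tensor n → Prop
  | [], _, Z, X => X = Z
  | k :: l, n, Z, X => ∃ (U : Matrix (Fin (n k)) (Fin (r k)) ℝ) (σ : Fin (r k) → ℝ)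
      (V : Matrix (RestIdx n k) (Fin (r k)) ℝ),
      IsTruncationStep k (IsSTHOSVD r l (Function.update n k (r k))) Z U σ V X

/-- The projection `Y ↦ UUᵀY + YVVᵀ - UUᵀYVVᵀ` onto the matrices of the form `U Rᵀ + L Vᵀ`. -/
def tangentProj {a b : Type*} [Fintype a] [Fintype b] {ρ : ℕ}
    (U : Matrix a (Fin ρ) ℝ) (V : Matrix b (Fin ρ) ℝ) (Y : Matrix a b ℝ) : Matrix a b ℝ :=
  U * U.transpose * Y + Y * (V * V.transpose) - U * U.transpose * Y * (V * V.transpose)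

/-- First-mode restricted isometry property of `A` with rank `ρ` and constant `R`. -/
def FirstModeRIP {d m : ℕ} [NeZero d] {n : Fin d → ℕ}
    (A : Tensor n →ₗ[ℝ] EuclideanSpace ℝ (Fin m)) (ρ : ℕ) (R : ℝ) : Prop :=
  ∀ Z : Tensor n, (unfold 0 Z).rank ≤ ρ →
    (1 - R) * ‖Z‖ ^ 2 ≤ ‖A Z‖ ^ 2 ∧ ‖A Z‖ ^ 2 ≤ (1 + R) * ‖Z‖ ^ 2

/-- The `i`-th largest singular value of a matrix, `i = 1, 2, …`. -/
noncomputable def singularValue {a b : Type*} [Fintype a] [Fintype b] [DecidableEq b]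
    (M : Matrix a b ℝ) (i : ℕ) : ℝ :=
  (Matrix.toEuclideanLin M).singularValues (i - 1)

/-- The condition number `κ₁ = σ₁(M₁(T)) / σ_ρ(M₁(T))` in the first mode. -/
noncomputable def kappa₁ {d : ℕ} [NeZero d] {n : Fin d → ℕ} (T : Tensor n) (ρ : ℕ) : ℝ :=
  singularValue (unfold 0 T) 1 / singularValue (unfold 0 T) ρ

/-- A run of the single mode quasi Riemannian gradient descent algorithm, with step sizes `α`, for
the recovery of `T` from `A T`. In every iteration, `X k` is an ST-HOSVD (all modes in their
order) of `W k`, whose first-mode truncated SVD is `U k, σ k, V k`, and `Xhat k` is the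
corresponding first-mode truncation of `W k`; here `W 0 = A*A(T)`. All choices that the singular
value decompositions leave open are allowed. -/
structure IsRun {d m : ℕ} [NeZero d] {n : Fin d → ℕ}
    (A : Tensor n →ₗ[ℝ] EuclideanSpace ℝ (Fin m)) (T : Tensor n) (r : Fin d → ℕ) (α : ℕ → ℝ)
    (X Xhat W : ℕ → Tensor n)
    (U : ℕ → Matrix (Fin (n 0)) (Fin (r 0)) ℝ) (σ : ℕ → Fin (r 0) → ℝ)
    (V : ℕ → Matrix (RestIdx n 0) (Fin (r 0)) ℝ) : Prop where
  init : W 0 = A.adjoint (A T)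
  st_hosvd : ∀ k, IsTruncationStep 0
    (IsSTHOSVD r (List.finRange d).tail (Function.update n 0 (r 0))) (W k) (U k) (σ k) (V k) (X k)
  truncation : ∀ k, Xhat k = fold 0 (U k * Matrix.diagonal (σ k) * (V k).transpose)
  step : ∀ k, W (k + 1) =
    fold 0 (tangentProj (U k) (V k) (unfold 0 (X k + α k • A.adjoint (A (T - X k)))))

/-- The rate `γ₁`, as a function of the order `d`, the rank `ρ` in the first mode, the condition
number `κ` and the restricted isometry constant `R`. -/
noncomputable def gamma₁ (d ρ : ℕ) (κ R : ℝ) : ℝ :=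
  R * (8 * √(ρ : ℝ) * κ * ((√((d : ℝ) - 1) + 1) * (R + 2) + R) + √(d : ℝ) + 3)

end SMQRGD

/-! Write `P` for the tangent projection at step `k` and `E = X k - T`. Since `T = P T + (I - P) T`,
the new error is `W (k+1) - T = P (I - A*A) E - (I - P) T`. The first term is at most `R ‖E‖`:
tested against the tangent direction it produces, only matrices of first-mode rank at most `3 r 0`
occur, so polarized restricted isometry applies (`norm_fold_tangentProj_sub_le`). The second is a
curvature term: `(I - UUᵀ) T (I - VVᵀ)` is at most `‖Xhat k - T‖`, and also at most `‖Xhat k - T‖² /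
s`, with `s` the smallest positive singular value of `unfold 0 T`
(`sq_mul_frobSq_sub_tangentProj_le`). Eckart–Young and quasi-optimality of ST-HOSVD bound `‖Xhat k -
T‖` and `‖X k - T‖` by 2 and `√d + 1` times `‖W k - T‖`. Hence the errors `e k = ‖W (k+1) - T‖`
satisfy `e (k+1) ≤ R (√d + 1) e k + (4/s) (e k)²`. The first error is `O(R) ‖T‖`, and `‖T‖ / s ≤ √(r
0) κ₁`, so the quadratic term is absorbed into the linear rate `γ₁`. -/

namespace SMQRGD

open Matrix

/-! ### Frobenius norm and orthonormal columns -/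

section Frobenius

variable {a b c : Type*} [Fintype a] [Fintype b] [Fintype c]

/-- The squared Frobenius norm of a real matrix. -/
def frobSq (M : Matrix a b ℝ) : ℝ := ∑ i, ∑ j, M i j ^ 2

lemma frobSq_nonneg (M : Matrix a b ℝ) : 0 ≤ frobSq M :=
  Finset.sum_nonneg fun _ _ => Finset.sum_nonneg fun _ _ => sq_nonneg _

lemma frobSq_transpose (M : Matrix a b ℝ) : frobSq Mᵀ = frobSq M :=
  Finset.sum_comm

lemma frobSq_eq_trace (M : Matrix a b ℝ) : frobSq M = (Mᵀ * M).trace := by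
  simp only [frobSq, trace, diag_apply, mul_apply, transpose_apply, pow_two]
  exact Finset.sum_comm

lemma frobSq_orthonormal_mul [DecidableEq a] {U : Matrix b a ℝ} (hU : Uᵀ * U = 1)
    (M : Matrix a c ℝ) : frobSq (U * M) = frobSq M := by
  rw [frobSq_eq_trace, frobSq_eq_trace, transpose_mul, Matrix.mul_assoc, ← Matrix.mul_assoc Uᵀ,
    hU, Matrix.one_mul]

lemma frobSq_mul_orthonormal_transpose [DecidableEq a] {V : Matrix b a ℝ} (hV : Vᵀ * V = 1)
    (M : Matrix c a ℝ) : frobSq (M * Vᵀ) = frobSq M := by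
  rw [← frobSq_transpose, transpose_mul, transpose_transpose, frobSq_orthonormal_mul hV,
    frobSq_transpose]

/-- Pythagoras for a matrix whose columns are orthogonal to the range of `U`. -/
lemma frobSq_mul_add [DecidableEq a] {U : Matrix b a ℝ} (hU : Uᵀ * U = 1)
    (M : Matrix a c ℝ) {N : Matrix b c ℝ} (hN : Uᵀ * N = 0) :
    frobSq (U * M + N) = frobSq M + frobSq N := by
  have h1 : (U * M)ᵀ * N = 0 := by rw [transpose_mul, Matrix.mul_assoc, hN, Matrix.mul_zero]
  have h2 : Nᵀ * (U * M) = 0 := by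
    rw [← transpose_transpose (Nᵀ * (U * M)), transpose_mul, transpose_transpose, h1,
      transpose_zero]
  rw [← frobSq_orthonormal_mul hU M]
  simp only [frobSq_eq_trace, transpose_add, Matrix.add_mul, Matrix.mul_add, h1, h2, trace_add,
    add_zero, zero_add]

lemma frobSq_eq_add_residual [DecidableEq a] {U : Matrix b a ℝ} (hU : Uᵀ * U = 1)
    (M : Matrix b c ℝ) : frobSq M = frobSq (Uᵀ * M) + frobSq (M - U * (Uᵀ * M)) := by
  rw [← frobSq_mul_add hU]
  · rw [add_sub_cancel]
  · rw [Matrix.mul_sub, ← Matrix.mul_assoc Uᵀ U, hU, Matrix.one_mul, sub_self]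

lemma frobSq_transpose_mul_le [DecidableEq a] {U : Matrix b a ℝ} (hU : Uᵀ * U = 1)
    (M : Matrix b c ℝ) : frobSq (Uᵀ * M) ≤ frobSq M := by
  rw [frobSq_eq_add_residual hU M]
  linarith [frobSq_nonneg (M - U * (Uᵀ * M))]

lemma frobSq_residual_le [DecidableEq a] {U : Matrix b a ℝ} (hU : Uᵀ * U = 1)
    (M : Matrix b c ℝ) : frobSq (M - U * (Uᵀ * M)) ≤ frobSq M := by
  rw [frobSq_eq_add_residual hU M]
  linarith [frobSq_nonneg (Uᵀ * M)]

lemma frobSq_mul_le (M : Matrix a b ℝ) (N : Matrix b c ℝ) :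
    frobSq (M * N) ≤ frobSq M * frobSq N := by
  rw [← frobSq_transpose N]
  simp only [frobSq, mul_apply]
  rw [Finset.sum_mul_sum]
  exact Finset.sum_le_sum fun i _ => Finset.sum_le_sum fun j _ =>
    Finset.sum_mul_sq_le_sq_mul_sq _ _ _

lemma frobSq_orthonormal [DecidableEq a] {U : Matrix b a ℝ} (hU : Uᵀ * U = 1) :
    frobSq U = Fintype.card a := by
  rw [frobSq_eq_trace, hU, trace_one]

end Frobenius

/-! ### Singular value decomposition and Eckart–Young -/

section SVD

variable {a b : Type*} [Fintype a] [Fintype b]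

lemma singularValue_nonneg [DecidableEq b] (M : Matrix a b ℝ) (i : ℕ) :
    0 ≤ singularValue M i := LinearMap.singularValues_nonneg _ _

lemma singularValue_antitone [DecidableEq b] (M : Matrix a b ℝ) : Antitone (singularValue M) :=
  fun _ _ h => LinearMap.singularValues_antitone _ (Nat.sub_le_sub_right h 1)

lemma finrank_range_toEuclideanLin [DecidableEq b] (M : Matrix a b ℝ) :
    Module.finrank ℝ (Matrix.toEuclideanLin M).range = M.rank := by
  rw [Matrix.rank_eq_finrank_range_toLin M (PiLp.basisFun 2 ℝ a) (PiLp.basisFun 2 ℝ b)]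
  rfl

lemma singularValue_succ_pos_iff [DecidableEq b] (M : Matrix a b ℝ) (i : ℕ) :
    0 < singularValue M (i + 1) ↔ i < M.rank := by
  rw [singularValue, LinearMap.singularValues_pos_iff_lt_finrank_range,
    finrank_range_toEuclideanLin, Nat.add_sub_cancel]

/-- Every matrix has a singular value decomposition with as many terms as its rank. -/
theorem exists_isSVD [DecidableEq b] (M : Matrix a b ℝ) :
    ∃ (U : Matrix a (Fin M.rank) ℝ) (V : Matrix b (Fin M.rank) ℝ),
      IsSVD M U (fun i => singularValue M (i + 1)) V := by
  set L := Matrix.toEuclideanLin M with hL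
  have hn : Module.finrank ℝ (EuclideanSpace ℝ b) = Fintype.card b := finrank_euclideanSpace
  set v := L.isSymmetric_adjoint_comp_self.eigenvectorBasis hn with hv
  have hr : M.rank ≤ Fintype.card b := M.rank_le_card_width
  set e : Fin M.rank → Fin (Fintype.card b) := Fin.castLE hr with he
  -- The `v i` are eigenvectors of `L*L`, so their images are orthogonal with lengths the singular
  -- values; normalized, they are the left singular vectors.
  have hinner : ∀ i j, inner ℝ (L (v i)) (L (v j)) =
      if i = j then L.singularValues j ^ 2 else 0 := by
    intro i j
    have h := L.isSymmetric_adjoint_comp_self.apply_eigenvectorBasis hn j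
    rw [← LinearMap.adjoint_inner_right, ← LinearMap.comp_apply, h, inner_smul_right,
      orthonormal_iff_ite.mp v.orthonormal i j, L.sq_singularValues_fin hn]
    simp
  have hpos : ∀ i : Fin M.rank, 0 < L.singularValues (i : ℕ) := fun i =>
    (singularValue_succ_pos_iff M i).mpr i.2
  have hsv : ∀ i : ℕ, singularValue M (i + 1) = L.singularValues i := fun _ => rfl
  refine ⟨Matrix.of fun x i => (L (v (e i))) x / L.singularValues (i : ℕ),
    Matrix.of fun y i => v (e i) y, ?_, ?_, ?_, fun i => singularValue_nonneg _ _, ?_⟩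
  · ext i j
    have h := hinner (e i) (e j)
    rw [PiLp.inner_apply] at h
    simp only [mul_apply, transpose_apply, of_apply, one_apply]
    have h' : ∑ x, L (v (e i)) x / L.singularValues (i : ℕ) *
        (L (v (e j)) x / L.singularValues (j : ℕ)) =
        (∑ x, inner ℝ (L (v (e i)) x) (L (v (e j)) x)) /
          (L.singularValues (i : ℕ) * L.singularValues (j : ℕ)) := by
      rw [Finset.sum_div]
      refine Finset.sum_congr rfl fun x _ => ?_
      simp only [RCLike.inner_apply, conj_trivial]
      rw [div_mul_div_comm, mul_comm (L (v (e i)) x)]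
    rw [h', h]
    by_cases hij : i = j
    · subst hij
      have := (hpos i).ne'
      simp only [if_true, he, Fin.val_castLE]
      field_simp
    · rw [if_neg hij, if_neg (fun h => hij (Fin.castLE_injective hr h)), zero_div]
  · ext i j
    have h := orthonormal_iff_ite.mp v.orthonormal (e i) (e j)
    rw [PiLp.inner_apply] at h
    simp only [mul_apply, transpose_apply, of_apply, one_apply]
    simp only [RCLike.inner_apply, conj_trivial] at h
    simp_rw [mul_comm (v (e i) _), h]
    exact if_congr (Fin.castLE_injective hr).eq_iff rfl rfl
  · exact fun i j h => singularValue_antitone M (Nat.succ_le_succ h)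
  · ext x y
    have h1 : M x y = L (EuclideanSpace.single y 1) x := by
      simp [hL, Matrix.toLpLin_apply]
    rw [h1, ← v.sum_repr (EuclideanSpace.single y 1), map_sum, mul_apply]
    simp only [WithLp.ofLp_sum, Finset.sum_apply, map_smul, PiLp.smul_apply, smul_eq_mul,
      v.repr_apply_apply, mul_diagonal, of_apply, transpose_apply]
    symm
    -- Indices beyond the rank have zero singular value, hence `L (v i) = 0`, and drop out of the
    -- expansion.
    refine Fintype.sum_of_injective e (Fin.castLE_injective hr) _ _ ?_ ?_
    · intro i hi
      have h0 : L.singularValues (i : ℕ) = 0 := by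
        by_contra hne
        apply hi
        have : (i : ℕ) < M.rank := (singularValue_succ_pos_iff M i).mp
          (lt_of_le_of_ne (singularValue_nonneg _ _) (Ne.symm hne))
        exact ⟨⟨i, this⟩, rfl⟩
      have h2 := hinner i i
      rw [if_pos rfl, h0, zero_pow two_ne_zero, inner_self_eq_zero] at h2
      simp [h2]
    · intro i
      have := (hpos i).ne'
      rw [hsv]
      simp only [EuclideanSpace.inner_single_right, conj_trivial]
      field_simp

lemma IsSVD.transpose_mul {M : Matrix a b ℝ} {p : ℕ} {U : Matrix a (Fin p) ℝ} {σ : Fin p → ℝ}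
    {V : Matrix b (Fin p) ℝ} (h : IsSVD M U σ V) : Uᵀ * M = diagonal σ * Vᵀ := by
  rw [h.eq, Matrix.mul_assoc U, ← Matrix.mul_assoc Uᵀ U, h.left_orthonormal, Matrix.one_mul]

lemma IsSVD.mul_transpose_mul {M : Matrix a b ℝ} {p : ℕ} {U : Matrix a (Fin p) ℝ}
    {σ : Fin p → ℝ} {V : Matrix b (Fin p) ℝ} (h : IsSVD M U σ V) : U * (Uᵀ * M) = M := by
  rw [h.transpose_mul, ← Matrix.mul_assoc, ← h.eq]

lemma IsSVD.mul_right {M : Matrix a b ℝ} {p : ℕ} {U : Matrix a (Fin p) ℝ} {σ : Fin p → ℝ}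
    {V : Matrix b (Fin p) ℝ} (h : IsSVD M U σ V) : M * V = U * diagonal σ := by
  rw [h.eq, Matrix.mul_assoc, h.right_orthonormal, Matrix.mul_one]

lemma frobSq_diagonal {p : ℕ} (σ : Fin p → ℝ) : frobSq (diagonal σ) = ∑ i, σ i ^ 2 := by
  refine Finset.sum_congr rfl fun i _ => ?_
  rw [Finset.sum_eq_single i (fun j _ h => by rw [diagonal_apply_ne' _ h]; simp) (by simp),
    diagonal_apply_eq]

lemma IsSVD.frobSq_eq {M : Matrix a b ℝ} {p : ℕ} {U : Matrix a (Fin p) ℝ} {σ : Fin p → ℝ}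
    {V : Matrix b (Fin p) ℝ} (h : IsSVD M U σ V) : frobSq M = ∑ i, σ i ^ 2 := by
  rw [h.eq, Matrix.mul_assoc, frobSq_orthonormal_mul h.left_orthonormal,
    frobSq_mul_orthonormal_transpose h.right_orthonormal, frobSq_diagonal]

section Truncated

variable {M : Matrix a b ℝ} {ρ : ℕ} {U : Matrix a (Fin ρ) ℝ} {σ : Fin ρ → ℝ}
  {V : Matrix b (Fin ρ) ℝ}

lemma IsTruncatedSVD.left_orthonormal (h : IsTruncatedSVD M U σ V) : Uᵀ * U = 1 := by
  obtain ⟨p, hp, U', σ', V', hsvd, rfl, -, -⟩ := h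
  ext i j
  have := congrFun (congrFun hsvd.left_orthonormal (Fin.castLE hp i)) (Fin.castLE hp j)
  simpa [mul_apply, one_apply] using this

lemma IsTruncatedSVD.right_orthonormal (h : IsTruncatedSVD M U σ V) : Vᵀ * V = 1 := by
  obtain ⟨p, hp, U', σ', V', hsvd, -, -, rfl⟩ := h
  ext i j
  have := congrFun (congrFun hsvd.right_orthonormal (Fin.castLE hp i)) (Fin.castLE hp j)
  simpa [mul_apply, one_apply] using this

lemma IsTruncatedSVD.transpose_mul (h : IsTruncatedSVD M U σ V) :
    Uᵀ * M = diagonal σ * Vᵀ := by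
  obtain ⟨p, hp, U', σ', V', hsvd, rfl, rfl, rfl⟩ := h
  ext i j
  have := congrFun (congrFun hsvd.transpose_mul (Fin.castLE hp i)) j
  simpa [mul_apply, diagonal_apply] using this

/-- Mass `w i ≤ 1` of total at most `ρ`, weighted by a decreasing sequence, is largest on the first
`ρ` entries. -/
lemma sum_mul_le_sum_castLE {p : ℕ} (hp : ρ ≤ p) {s w : Fin p → ℝ} (hs : Antitone s)
    (hs0 : ∀ i, 0 ≤ s i) (hw0 : ∀ i, 0 ≤ w i) (hw1 : ∀ i, w i ≤ 1) (hw : ∑ i, w i ≤ ρ) :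
    ∑ i, s i * w i ≤ ∑ i : Fin ρ, s (Fin.castLE hp i) := by
  -- The threshold `t` is the first discarded entry, or 0 if none is discarded. Then `s i * w i ≤ t
  -- * w i + (s i - t)`, the last term only for `i < ρ`, and the `t` terms sum to at most `t * ρ`.
  obtain ⟨t, ht0, ht1, ht2⟩ : ∃ t : ℝ, 0 ≤ t ∧ (∀ i : Fin p, (i : ℕ) < ρ → t ≤ s i) ∧
      ∀ i : Fin p, ρ ≤ (i : ℕ) → s i ≤ t := by
    by_cases h : ρ < p
    · exact ⟨s ⟨ρ, h⟩, hs0 _, fun i hi => hs (Fin.le_def.mpr hi.le),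
        fun i hi => hs (Fin.le_def.mpr hi)⟩
    · exact ⟨0, le_rfl, fun i _ => hs0 i, fun i hi => absurd i.2 (by omega)⟩
  have h1 : ∑ i, s i * w i ≤ ∑ i, (t * w i + if (i : ℕ) < ρ then s i - t else 0) := by
    refine Finset.sum_le_sum fun i _ => ?_
    split_ifs with h
    · nlinarith [ht1 i h, hw1 i]
    · nlinarith [ht2 i (not_lt.mp h), hw0 i]
  have h2 : ∑ i : Fin ρ, (s (Fin.castLE hp i) - t) =
      ∑ i : Fin p, if (i : ℕ) < ρ then s i - t else 0 := by
    refine Fintype.sum_of_injective (Fin.castLE hp) (Fin.castLE_injective hp) _ _ ?_ ?_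
    · intro i hi
      rw [if_neg]
      exact fun h => hi ⟨⟨i, h⟩, rfl⟩
    · intro i
      simp
  rw [Finset.sum_add_distrib, ← Finset.mul_sum, ← h2, Finset.sum_sub_distrib] at h1
  simp only [Finset.sum_const, Finset.card_univ, Fintype.card_fin, nsmul_eq_mul] at h1
  nlinarith

/-- The Eckart–Young theorem in the Frobenius norm. -/
theorem IsTruncatedSVD.eckart_young (h : IsTruncatedSVD M U σ V) (Z : Matrix a b ℝ)
    (hZ : Z.rank ≤ ρ) : frobSq (M - U * (Uᵀ * M)) ≤ frobSq (M - Z) := by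
  classical
  -- Projecting `M` onto the column space of `Z` is at least as good as `Z`, so it suffices to
  -- compare the captured masses `frobSq (Qᵀ * M)` and `frobSq (Uᵀ * M)`.
  obtain ⟨Q, Q', hQ⟩ := exists_isSVD Z
  have hQo := hQ.left_orthonormal
  have e1 := frobSq_eq_add_residual h.left_orthonormal M
  have e2 := frobSq_eq_add_residual hQo M
  have e3 := frobSq_residual_le hQo (M - Z)
  have e4 : M - Z - Q * (Qᵀ * (M - Z)) = M - Q * (Qᵀ * M) := by
    rw [Matrix.mul_sub, Matrix.mul_sub, hQ.mul_transpose_mul]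
    abel
  rw [e4] at e3
  suffices frobSq (Qᵀ * M) ≤ frobSq (Uᵀ * M) by linarith
  rw [h.transpose_mul, frobSq_mul_orthonormal_transpose h.right_orthonormal, frobSq_diagonal]
  obtain ⟨p, hp, U', σ', V', hsvd, rfl, rfl, rfl⟩ := h
  -- The weight of `σ' i ^ 2` is the squared length of the projection of the `i`-th singular vector:
  -- at most 1 each, and at most `rank Z` in total.
  have e5 : frobSq (Qᵀ * M) = ∑ i, σ' i ^ 2 * ∑ c, (Qᵀ * U') c i ^ 2 := by
    rw [hsvd.eq, ← Matrix.mul_assoc, ← Matrix.mul_assoc,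
      frobSq_mul_orthonormal_transpose hsvd.right_orthonormal, ← frobSq_transpose]
    refine Finset.sum_congr rfl fun i _ => ?_
    rw [Finset.mul_sum]
    refine Finset.sum_congr rfl fun c _ => ?_
    rw [transpose_apply, mul_diagonal]
    ring
  rw [e5]
  refine sum_mul_le_sum_castLE hp (s := fun i => σ' i ^ 2) ?_ (fun i => sq_nonneg _)
    (w := fun i => ∑ c, (Qᵀ * U') c i ^ 2)
    (fun i => Finset.sum_nonneg fun _ _ => sq_nonneg _) ?_ ?_
  · exact fun i j hij => pow_le_pow_left₀ (hsvd.nonneg j) (hsvd.antitone hij) 2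
  · intro i
    have h1 := frobSq_transpose_mul_le hQo (U'.submatrix id (fun _ : Unit => i))
    have h2 := congrFun (congrFun hsvd.left_orthonormal i) i
    simp only [mul_apply, transpose_apply, one_apply_eq] at h2
    simp only [frobSq, mul_apply, submatrix_apply, id_eq, Finset.univ_unique, Finset.sum_const,
      Finset.card_singleton, one_smul, transpose_apply, pow_two] at h1 ⊢
    linarith
  · rw [Finset.sum_comm]
    have h1 := frobSq_transpose_mul_le hsvd.left_orthonormal Q
    rw [← frobSq_transpose, Matrix.transpose_mul, transpose_transpose] at h1
    refine le_trans h1 ?_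
    rw [frobSq_orthonormal hQo, Fintype.card_fin]
    exact Nat.cast_le.mpr hZ

end Truncated

end SVD

lemma frobSq_neg {a b : Type*} [Fintype a] [Fintype b] (M : Matrix a b ℝ) :
    frobSq (-M) = frobSq M := by
  simp [frobSq]

/-! ### Matricizations and mode products -/

section Tensor

variable {d : ℕ} {n : Fin d → ℕ}

@[simp] lemma unfold_fold (k : Fin d) (M : Matrix (Fin (n k)) (RestIdx n k) ℝ) :
    unfold k (fold k M) = M := by
  ext; simp [unfold, fold]

@[simp] lemma unfoldUpdate_foldUpdate (k : Fin d) {p : ℕ} (M : Matrix (Fin p) (RestIdx n k) ℝ) :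
    unfoldUpdate k (foldUpdate k M) = M := by
  ext; simp [unfoldUpdate, foldUpdate]

lemma unfold_add (k : Fin d) (X Y : Tensor n) : unfold k (X + Y) = unfold k X + unfold k Y := rfl

lemma unfold_sub (k : Fin d) (X Y : Tensor n) : unfold k (X - Y) = unfold k X - unfold k Y := rfl

lemma unfold_smul (k : Fin d) (c : ℝ) (X : Tensor n) : unfold k (c • X) = c • unfold k X := rfl

lemma unfoldUpdate_sub (k : Fin d) {p : ℕ} (X Y : Tensor (Function.update n k p)) :
    unfoldUpdate k (X - Y) = unfoldUpdate k X - unfoldUpdate k Y := rfl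

@[simp] lemma unfold_modeProduct (k : Fin d) {p : ℕ} (Y : Tensor (Function.update n k p))
    (U : Matrix (Fin (n k)) (Fin p) ℝ) :
    unfold k (modeProduct k Y U) = U * unfoldUpdate k Y := unfold_fold k _

lemma norm_sq_eq_frobSq (k : Fin d) (X : Tensor n) : ‖X‖ ^ 2 = frobSq (unfold k X) := by
  rw [EuclideanSpace.real_norm_sq_eq, ← (splitIdx n k).symm.sum_comp, Fintype.sum_prod_type]
  rfl

lemma norm_sq_eq_frobSq_unfoldUpdate (k : Fin d) {p : ℕ} (Y : Tensor (Function.update n k p)) :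
    ‖Y‖ ^ 2 = frobSq (unfoldUpdate k Y) := by
  rw [EuclideanSpace.real_norm_sq_eq, ← (splitIdxUpdate n k p).symm.sum_comp,
    Fintype.sum_prod_type]
  rfl

lemma inner_eq_trace (k : Fin d) (X Y : Tensor n) :
    inner ℝ X Y = ((unfold k X)ᵀ * unfold k Y).trace := by
  rw [PiLp.inner_apply, ← (splitIdx n k).symm.sum_comp, Fintype.sum_prod_type, Finset.sum_comm]
  simp [trace, mul_apply, unfold, mul_comm]

/-- A mode product does not increase the rank of any matricization. -/
theorem rank_unfold_foldUpdate_mul_le (j k : Fin d) {p : ℕ} (S : Matrix (Fin p) (Fin (n k)) ℝ)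
    (X : Tensor n) : (unfold j (foldUpdate k (S * unfold k X))).rank ≤ (unfold j X).rank := by
  by_cases hjk : j = k
  · subst hjk
    have h : unfold j (foldUpdate j (S * unfold j X)) = (S * unfold j X).submatrix
        (finCongr (Function.update_self j p n))
        (Equiv.piCongrRight fun l : {l // l ≠ j} =>
          finCongr (Function.update_of_ne l.2 p n)) := by
      ext x y
      simp [unfold, foldUpdate, splitIdxUpdate]
    rw [h, rank_submatrix]
    exact rank_mul_le_right _ _
  -- For `j ≠ k` a rank factorization `P * Q` of `unfold j X` survives: the mode-`k` product acts on
  -- the column index only, so it changes `Q` and merely reindexes `P`.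
  · obtain ⟨P, Q', hQ⟩ := exists_isSVD (unfold j X)
    set Q := Pᵀ * unfold j X with hQdef
    have hPQ : unfold j X = P * Q := hQ.mul_transpose_mul.symm
    -- `g y s` is the multi-index `y` with its mode-`k` entry replaced by `s`.
    let g (y : RestIdx (Function.update n k p) j) (s : Fin (n k)) : RestIdx n j := fun l =>
      if h : (l : Fin d) = k then h ▸ s
      else finCongr (Function.update_of_ne h p n) (y l)
    have hne : k ≠ j := Ne.symm hjk
    let Q₁ : Matrix (Fin (unfold j X).rank) (RestIdx (Function.update n k p) j) ℝ :=
      Matrix.of fun c y => ∑ s, S (finCongr (Function.update_self k p n) (y ⟨k, hne⟩)) s *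
        Q c (g y s)
    have h : unfold j (foldUpdate k (S * unfold k X)) =
        P.submatrix (finCongr (Function.update_of_ne hjk p n)) id * Q₁ := by
      ext x y
      have hX : ∀ i, X i = ∑ c, P (i j) c * Q c (fun l => i l) := by
        intro i
        have := congrFun (congrFun hPQ (i j)) (fun l => i l)
        rw [mul_apply] at this
        rw [← this, unfold, of_apply]
        exact congrArg X ((splitIdx n j).symm_apply_apply i).symm
      rw [mul_apply]
      change _ = ∑ c, P (finCongr (Function.update_of_ne hjk p n) x) c *
        ∑ s, S (finCongr (Function.update_self k p n) (y ⟨k, hne⟩)) s * Q c (g y s)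
      simp only [unfold, foldUpdate, of_apply, mul_apply, hX, Finset.mul_sum]
      rw [Finset.sum_comm]
      refine Finset.sum_congr rfl fun c _ => Finset.sum_congr rfl fun s _ => ?_
      rw [mul_left_comm]
      congr 1
      · congr 1
        simp [splitIdx, splitIdxUpdate, Equiv.piSplitAt, hjk]
      · congr 1
        · congr 1
          simp [splitIdx, splitIdxUpdate, Equiv.piSplitAt, hne]
        · congr 1
          funext l
          by_cases hl : (l : Fin d) = k
          · obtain ⟨l, hl'⟩ := l
            subst hl
            simp [g, splitIdx, splitIdxUpdate, Equiv.piSplitAt]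
          · have := l.2
            simp [g, splitIdx, splitIdxUpdate, Equiv.piSplitAt, hl, this]
    rw [h]
    exact (rank_mul_le_left _ _).trans (rank_le_width _)

end Tensor

/-! ### Quasi-optimality of ST-HOSVD -/

section STHOSVD

variable {d : ℕ} {n : Fin d → ℕ} {k : Fin d} {ρ : ℕ}
  {P : Tensor (Function.update n k ρ) → Tensor (Function.update n k ρ) → Prop} {Z X : Tensor n}
  {U : Matrix (Fin (n k)) (Fin ρ) ℝ} {σ : Fin ρ → ℝ} {V : Matrix (RestIdx n k) (Fin ρ) ℝ}

/-- Pythagoras: later truncations change the result only inside the range of `U`, while the error of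
this truncation is orthogonal to it. -/
lemma IsTruncationStep.exists_norm_sub_sq (h : IsTruncationStep k P Z U σ V X) :
    ∃ Y, P (foldUpdate k (Uᵀ * unfold k Z)) Y ∧ X = modeProduct k Y U ∧
      ‖X - Z‖ ^ 2 = ‖Y - foldUpdate k (Uᵀ * unfold k Z)‖ ^ 2 +
        frobSq (unfold k Z - U * (Uᵀ * unfold k Z)) := by
  obtain ⟨hsvd, Y, hY, rfl⟩ := h
  rw [← hsvd.transpose_mul] at hY
  refine ⟨Y, hY, rfl, ?_⟩
  have hU := hsvd.left_orthonormal
  rw [norm_sq_eq_frobSq k, norm_sq_eq_frobSq_unfoldUpdate, unfold_sub, unfold_modeProduct,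
    unfoldUpdate_sub, unfoldUpdate_foldUpdate, frobSq_eq_add_residual hU, Matrix.mul_sub,
    ← Matrix.mul_assoc Uᵀ U, hU, Matrix.one_mul, Matrix.mul_sub, sub_sub_sub_cancel_left,
    ← frobSq_neg (unfold k Z - _), neg_sub]

lemma norm_foldUpdate_sub_sq_le (hU : Uᵀ * U = 1) (Z T : Tensor n) :
    ‖foldUpdate k (Uᵀ * unfold k Z) - foldUpdate k (Uᵀ * unfold k T)‖ ^ 2 ≤ ‖Z - T‖ ^ 2 := by
  rw [norm_sq_eq_frobSq k (Z - T), norm_sq_eq_frobSq_unfoldUpdate, unfoldUpdate_sub,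
    unfoldUpdate_foldUpdate, unfoldUpdate_foldUpdate, ← Matrix.mul_sub, unfold_sub]
  exact frobSq_transpose_mul_le hU _

/-- Quasi-optimality of the sequentially truncated HOSVD. -/
theorem IsSTHOSVD.norm_sub_sq_le {r : Fin d → ℕ} {l : List (Fin d)} :
    ∀ {n : Fin d → ℕ} {Z X : Tensor n}, IsSTHOSVD r l n Z X →
      ∀ T : Tensor n, (∀ k ∈ l, (unfold k T).rank ≤ r k) →
        ‖X - Z‖ ^ 2 ≤ l.length * ‖Z - T‖ ^ 2 := by
  induction l with
  | nil =>
    rintro n Z X h T -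
    rw [IsSTHOSVD] at h
    simp [h]
  | cons k l ih =>
    rintro n Z X ⟨U, σ, V, h⟩ T hT
    have hsvd := h.1
    obtain ⟨Y, hY, -, hX⟩ := h.exists_norm_sub_sq
    -- The competitor `T` is compressed by the same `Uᵀ`: its ranks do not grow, nor does its
    -- distance to the compressed `Z`. Each mode therefore costs at most `‖Z - T‖²`.
    have h1 := ih hY (foldUpdate k (Uᵀ * unfold k T)) fun j hj =>
      (rank_unfold_foldUpdate_mul_le j k _ T).trans (hT j (List.mem_cons_of_mem _ hj))
    have h2 := norm_foldUpdate_sub_sq_le hsvd.left_orthonormal Z T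
    have h3 := hsvd.eckart_young (unfold k T) (hT k List.mem_cons_self)
    rw [← unfold_sub, ← norm_sq_eq_frobSq] at h3
    have h4 := mul_le_mul_of_nonneg_left h2 (Nat.cast_nonneg (α := ℝ) l.length)
    rw [hX, List.length_cons]
    push_cast
    linarith

end STHOSVD

/-! ### Normal component at a nearby low-rank matrix -/

section TangentSpace

variable {a b : Type*} [Fintype a] [Fintype b] {ρ : ℕ} {U : Matrix a (Fin ρ) ℝ}
  {V : Matrix b (Fin ρ) ℝ}

lemma frobSq_mul_orthonormal_le {c : Type*} [Fintype c] [DecidableEq c] {V : Matrix b c ℝ}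
    (hV : Vᵀ * V = 1) (M : Matrix a b ℝ) : frobSq (M * V) ≤ frobSq M := by
  rw [← frobSq_transpose, transpose_mul, ← frobSq_transpose M]
  exact frobSq_transpose_mul_le hV _

lemma frobSq_right_residual_le {c : Type*} [Fintype c] [DecidableEq c] {V : Matrix b c ℝ}
    (hV : Vᵀ * V = 1) (M : Matrix a b ℝ) : frobSq (M - M * (V * Vᵀ)) ≤ frobSq M := by
  have h := frobSq_residual_le hV Mᵀ
  rwa [← frobSq_transpose, transpose_sub, transpose_mul, transpose_mul, transpose_transpose,
    transpose_transpose, frobSq_transpose, Matrix.mul_assoc] at h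

/-- The normal projection factors as `(I - UUᵀ) Y (I - VVᵀ)`; both bounds on it start here. -/
lemma sub_tangentProj (Y : Matrix a b ℝ) : Y - tangentProj U V Y =
    (Y - U * (Uᵀ * Y)) - (Y - U * (Uᵀ * Y)) * (V * Vᵀ) := by
  simp only [tangentProj, Matrix.sub_mul, Matrix.mul_assoc]
  abel

/-- The component of `T` normal to the tangent space at `M = U Σ Vᵀ` is at most the distance of
`M` from `T`. -/
lemma frobSq_sub_tangentProj_le (hU : Uᵀ * U = 1) (hV : Vᵀ * V = 1) (T : Matrix a b ℝ)
    {M : Matrix a b ℝ} (hM : U * (Uᵀ * M) = M) :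
    frobSq (T - tangentProj U V T) ≤ frobSq (M - T) := by
  rw [sub_tangentProj, ← frobSq_neg (M - T), neg_sub]
  refine (frobSq_right_residual_le hV _).trans ?_
  have : T - U * (Uᵀ * T) = (T - M) - U * (Uᵀ * (T - M)) := by
    rw [Matrix.mul_sub, Matrix.mul_sub, hM]
    abel
  rw [this]
  exact frobSq_residual_le hU _

/-- The component of `T` normal to the tangent space at `M = U Σ Vᵀ` is at most the squared distance
of `M` from `T` divided by the smallest positive singular value of `T`. -/
theorem sq_mul_frobSq_sub_tangentProj_le [DecidableEq b] (hU : Uᵀ * U = 1) (hV : Vᵀ * V = 1)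
    (T : Matrix a b ℝ) {M : Matrix a b ℝ} (hM : U * (Uᵀ * M) = M) (hM' : M * (V * Vᵀ) = M) :
    singularValue T T.rank ^ 2 * frobSq (T - tangentProj U V T) ≤ frobSq (M - T) ^ 2 := by
  obtain ⟨Q, Q', hQ⟩ := exists_isSVD T
  set s : Fin T.rank → ℝ := fun i => singularValue T (i + 1) with hs
  have hpos : ∀ i, 0 < s i := fun i => (singularValue_succ_pos_iff T i).mpr i.2
  set G := T - U * (Uᵀ * T) with hG
  set H := T - T * (V * Vᵀ) with hH
  have hG1 : frobSq G ≤ frobSq (M - T) := by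
    have : G = (T - M) - U * (Uᵀ * (T - M)) := by
      rw [Matrix.mul_sub, Matrix.mul_sub, hM, hG]
      abel
    rw [this, ← frobSq_neg (M - T), neg_sub]
    exact frobSq_residual_le hU _
  have hH1 : frobSq H ≤ frobSq (M - T) := by
    have : H = (T - M) - (T - M) * (V * Vᵀ) := by
      rw [Matrix.sub_mul, hM', hH]
      abel
    rw [this, ← frobSq_neg (M - T), neg_sub]
    exact frobSq_right_residual_le hV _
  -- With the pseudoinverse `T⁺ = Q' S⁻¹ Qᵀ`, `T T⁺ T = T`. So the normal component `(I - UUᵀ) T (I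
  -- - VVᵀ)` equals `G T⁺ H`, where `G` and `H` are both as small as `M - T`: this gives the
  -- quadratic bound.
  have hTS : T * (Q' * (diagonal (fun i => (s i)⁻¹) * (Qᵀ * T))) = T := by
    have h2 : diagonal s * diagonal (fun i => (s i)⁻¹) = 1 := by
      rw [diagonal_mul_diagonal, ← diagonal_one]
      exact congrArg diagonal (funext fun i => mul_inv_cancel₀ (hpos i).ne')
    rw [← Matrix.mul_assoc, hQ.mul_right, Matrix.mul_assoc, ← Matrix.mul_assoc (diagonal s), h2,
      Matrix.one_mul, hQ.mul_transpose_mul]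
  have hGS : G * (Q' * (diagonal (fun i => (s i)⁻¹) * (Qᵀ * T))) = G := by
    rw [hG, Matrix.sub_mul, Matrix.mul_assoc U, Matrix.mul_assoc Uᵀ, hTS]
  have hfac : T - tangentProj U V T = (G * Q') * diagonal (fun i => (s i)⁻¹) * (Qᵀ * H) := by
    have h1 : G * (Q' * (diagonal (fun i => (s i)⁻¹) * (Qᵀ * (T * (V * Vᵀ))))) =
        G * (V * Vᵀ) := by
      conv_rhs => rw [← hGS]
      simp only [Matrix.mul_assoc]
    rw [sub_tangentProj, hH, Matrix.mul_sub, Matrix.mul_sub, Matrix.mul_assoc, Matrix.mul_assoc,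
      hGS, Matrix.mul_assoc, Matrix.mul_assoc, h1]
  have hinv : singularValue T T.rank ^ 2 *
      frobSq ((G * Q') * diagonal (fun i => (s i)⁻¹)) ≤ frobSq (G * Q') := by
    simp only [frobSq, mul_diagonal, Finset.mul_sum]
    refine Finset.sum_le_sum fun i _ => Finset.sum_le_sum fun j _ => ?_
    have h1 : singularValue T T.rank ≤ s j := singularValue_antitone T j.2
    have h2 : (singularValue T T.rank * (s j)⁻¹) ^ 2 ≤ 1 := by
      refine pow_le_one₀ (mul_nonneg (singularValue_nonneg _ _) (inv_nonneg.mpr (hpos j).le)) ?_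
      rw [← div_eq_mul_inv]
      exact div_le_one_of_le₀ h1 (hpos j).le
    calc _ = (singularValue T T.rank * (s j)⁻¹) ^ 2 * (G * Q') i j ^ 2 := by ring
      _ ≤ 1 * (G * Q') i j ^ 2 := mul_le_mul_of_nonneg_right h2 (sq_nonneg _)
      _ = _ := one_mul _
  have h3 := (frobSq_mul_orthonormal_le hQ.right_orthonormal G).trans hG1
  have h4 := (frobSq_transpose_mul_le hQ.left_orthonormal H).trans hH1
  calc singularValue T T.rank ^ 2 * frobSq (T - tangentProj U V T)
      ≤ singularValue T T.rank ^ 2 *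
          (frobSq ((G * Q') * diagonal (fun i => (s i)⁻¹)) * frobSq (Qᵀ * H)) := by
        rw [hfac]
        exact mul_le_mul_of_nonneg_left (frobSq_mul_le _ _) (sq_nonneg _)
    _ = singularValue T T.rank ^ 2 *
          frobSq ((G * Q') * diagonal (fun i => (s i)⁻¹)) * frobSq (Qᵀ * H) := by ring
    _ ≤ frobSq (M - T) * frobSq (M - T) :=
        mul_le_mul (hinv.trans h3) h4 (frobSq_nonneg _) (frobSq_nonneg _)
    _ = frobSq (M - T) ^ 2 := (pow_two _).symm

end TangentSpace

/-! ### Rank counts -/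

section Rank

variable {a b : Type*} [Fintype b]

lemma rank_add_le (M N : Matrix a b ℝ) : (M + N).rank ≤ M.rank + N.rank := by
  rw [Matrix.rank, Matrix.rank, Matrix.rank, mulVecLin_add]
  exact (Submodule.finrank_mono (LinearMap.range_add_le _ _)).trans
    (Submodule.finrank_add_le_finrank_add_finrank _ _)

lemma rank_smul_le (c : ℝ) (M : Matrix a b ℝ) : (c • M).rank ≤ M.rank := by
  classical
  rw [← Matrix.mul_one M, ← Matrix.mul_smul]
  exact (rank_mul_le_left _ _).trans (by rw [Matrix.mul_one])

lemma rank_mul_add_smul_le {ρ : ℕ} (U : Matrix a (Fin ρ) ℝ) (N : Matrix (Fin ρ) b ℝ) (c : ℝ)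
    (T : Matrix a b ℝ) : (U * N + c • T).rank ≤ ρ + T.rank :=
  (rank_add_le _ _).trans (add_le_add
    ((rank_mul_le_left _ _).trans (U.rank_le_card_width.trans_eq (Fintype.card_fin ρ)))
    (rank_smul_le _ _))

lemma rank_mul_add_mul_le {ρ : ℕ} (U : Matrix a (Fin ρ) ℝ) (N : Matrix (Fin ρ) b ℝ)
    (L : Matrix a (Fin ρ) ℝ) (V : Matrix (Fin ρ) b ℝ) (c : ℝ) (T : Matrix a b ℝ) :
    (U * N + L * V + c • T).rank ≤ ρ + ρ + T.rank := by
  refine (rank_add_le _ _).trans (add_le_add ((rank_add_le _ _).trans (add_le_add ?_ ?_))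
    (rank_smul_le _ _))
  · exact (rank_mul_le_left _ _).trans (U.rank_le_card_width.trans_eq (Fintype.card_fin ρ))
  · exact (rank_mul_le_left _ _).trans (L.rank_le_card_width.trans_eq (Fintype.card_fin ρ))

end Rank

/-! ### Orthogonality of the tangent projection -/

section TangentSpace

variable {a b : Type*} [Fintype a] [Fintype b] {ρ : ℕ} {U : Matrix a (Fin ρ) ℝ}
  {V : Matrix b (Fin ρ) ℝ}

lemma tangentProj_sub (Y Z : Matrix a b ℝ) :
    tangentProj U V (Y - Z) = tangentProj U V Y - tangentProj U V Z := by
  simp only [tangentProj, Matrix.mul_sub, Matrix.sub_mul]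
  abel

lemma tangentProj_eq_mul_add_mul (Y : Matrix a b ℝ) : tangentProj U V Y =
    U * (Uᵀ * Y) + ((Y - U * (Uᵀ * Y)) * V) * Vᵀ := by
  simp only [tangentProj, Matrix.sub_mul, Matrix.mul_assoc]
  abel

/-- `tangentProj` is an orthogonal projection. -/
lemma trace_tangentProj_transpose_mul (hU : Uᵀ * U = 1) (hV : Vᵀ * V = 1) (Y : Matrix a b ℝ) :
    ((tangentProj U V Y)ᵀ * tangentProj U V Y).trace = ((tangentProj U V Y)ᵀ * Y).trace := by
  set G := Y - U * (Uᵀ * Y) with hG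
  have hUG : Uᵀ * G = 0 := by
    rw [hG, Matrix.mul_sub, ← Matrix.mul_assoc Uᵀ U, hU, Matrix.one_mul, sub_self]
  have hGV : (G - G * (V * Vᵀ)) * V = 0 := by
    rw [Matrix.sub_mul, Matrix.mul_assoc, Matrix.mul_assoc V, hV, Matrix.mul_one, sub_self]
  have hN : Y - tangentProj U V Y = G - G * (V * Vᵀ) := sub_tangentProj Y
  have hUN : Uᵀ * (G - G * (V * Vᵀ)) = 0 := by
    rw [Matrix.mul_sub, ← Matrix.mul_assoc, hUG, Matrix.zero_mul, sub_zero]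
  have key : ((tangentProj U V Y)ᵀ * (Y - tangentProj U V Y)).trace = 0 := by
    rw [hN, tangentProj_eq_mul_add_mul, transpose_add, Matrix.add_mul, transpose_mul U,
      Matrix.mul_assoc, hUN, Matrix.mul_zero, zero_add, transpose_mul, transpose_transpose,
      Matrix.mul_assoc, trace_mul_comm, Matrix.mul_assoc, hGV, Matrix.mul_zero, trace_zero]
  rw [Matrix.mul_sub, trace_sub] at key
  linarith

end TangentSpace

/-! ### Consequences of restricted isometry -/

section RestrictedIsometry

variable {d m : ℕ} [NeZero d] {n : Fin d → ℕ} {A : Tensor n →ₗ[ℝ] EuclideanSpace ℝ (Fin m)}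
  {ρ : ℕ} {R : ℝ}

lemma FirstModeRIP.const_nonneg (h : FirstModeRIP A ρ R) {T : Tensor n} (hT : T ≠ 0)
    (hρ : (unfold 0 T).rank ≤ ρ) : 0 ≤ R := by
  obtain ⟨h1, h2⟩ := h T hρ
  have : 0 < ‖T‖ ^ 2 := by positivity
  by_contra hR
  nlinarith

/-- Polarization: scale `Z` and `Y` to equal norm, then use the upper bound on their sum and the
lower bound on their difference. The opposite sign follows by negating one argument. -/
lemma FirstModeRIP.inner_sub_inner_le (h : FirstModeRIP A ρ R) (Z Y : Tensor n)
    (hrank : ∀ s t : ℝ, (unfold 0 (s • Z + t • Y)).rank ≤ ρ) :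
    inner ℝ (A Z) (A Y) - inner ℝ Z Y ≤ R * (‖Z‖ * ‖Y‖) := by
  rcases eq_or_ne Z 0 with rfl | hZ
  · simp
  rcases eq_or_ne Y 0 with rfl | hY
  · simp
  have hZ' := norm_pos_iff.mpr hZ
  have hY' := norm_pos_iff.mpr hY
  have h1 := (h _ (hrank ‖Y‖ ‖Z‖)).2
  have h2 := (h _ (hrank ‖Y‖ (-‖Z‖))).1
  simp only [map_add, map_smul] at h1 h2
  simp only [norm_add_sq_real, inner_smul_left, inner_smul_right, norm_smul, mul_pow,
    Real.norm_eq_abs, sq_abs, abs_neg, conj_trivial] at h1 h2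
  have h3 : (‖Z‖ * ‖Y‖) * (inner ℝ (A Z) (A Y) - inner ℝ Z Y) ≤
      (‖Z‖ * ‖Y‖) * (R * (‖Z‖ * ‖Y‖)) := by
    linarith
  exact le_of_mul_le_mul_left h3 (mul_pos hZ' hY')

/-- The best rank-`ρ` approximation `X` of `A* A T` is close to `T`. -/
lemma FirstModeRIP.norm_sub_le_of_isBest {q : ℕ} (h : FirstModeRIP A q R) (T X : Tensor n)
    (hX : ‖X - A.adjoint (A T)‖ ≤ ‖T - A.adjoint (A T)‖)
    (hrank : ∀ s t : ℝ, (unfold 0 (s • (X - T) + t • T)).rank ≤ q) :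
    ‖X - T‖ ^ 2 ≤ 2 * R * (‖X - T‖ * ‖T‖) := by
  have h1 := h.inner_sub_inner_le (X - T) T hrank
  have h2 : ‖(X - T) + (T - A.adjoint (A T))‖ ^ 2 ≤ ‖T - A.adjoint (A T)‖ ^ 2 := by
    rw [sub_add_sub_cancel]
    exact pow_le_pow_left₀ (norm_nonneg _) hX 2
  rw [norm_add_sq_real, inner_sub_right, LinearMap.adjoint_inner_right] at h2
  linarith

variable {U : Matrix (Fin (n 0)) (Fin ρ) ℝ} {V : Matrix (RestIdx n 0) (Fin ρ) ℝ}

/-- One gradient step followed by the tangent space projection. -/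
lemma FirstModeRIP.norm_fold_tangentProj_sub_le {T X : Tensor n} (hT : (unfold 0 T).rank ≤ ρ)
    (h : FirstModeRIP A (3 * ρ) R) (hR : 0 ≤ R) (hU : Uᵀ * U = 1) (hV : Vᵀ * V = 1)
    {N : Matrix (Fin ρ) (RestIdx n 0) ℝ} (hX : unfold 0 X = U * N) :
    ‖fold 0 (tangentProj U V (unfold 0 (X + A.adjoint (A (T - X))))) - T‖ ≤
      R * ‖X - T‖ + ‖fold 0 (unfold 0 T - tangentProj U V (unfold 0 T))‖ := by
  set G := X - T with hG
  set F := G - A.adjoint (A G) with hF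
  set D : Tensor n := fold 0 (tangentProj U V (unfold 0 F)) with hD
  -- Tangential and normal parts of the error, from `X + A*A(T - X) = (I - A*A)(X - T) + T`.
  have hsplit : fold 0 (tangentProj U V (unfold 0 (X + A.adjoint (A (T - X))))) - T =
      D - fold 0 (unfold 0 T - tangentProj U V (unfold 0 T)) := by
    have h1 : X + A.adjoint (A (T - X)) = F + T := by
      rw [hF, hG, map_sub, map_sub, map_sub, map_sub]
      abel
    have h2 : ∀ M N : Matrix (Fin (n 0)) (RestIdx n 0) ℝ, fold 0 (M - N) = fold 0 M - fold 0 N :=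
      fun _ _ => rfl
    have h3 : fold 0 (unfold 0 T) = T := by
      ext i
      simp [fold, unfold]
    have h4 : tangentProj U V (unfold 0 (F + T)) =
        tangentProj U V (unfold 0 F) + tangentProj U V (unfold 0 T) := by
      have := tangentProj_sub (U := U) (V := V) (unfold 0 (F + T)) (unfold 0 T)
      rw [← unfold_sub, add_sub_cancel_right] at this
      rw [this, sub_add_cancel]
    have h5 : ∀ M N : Matrix (Fin (n 0)) (RestIdx n 0) ℝ, fold 0 (M + N) = fold 0 M + fold 0 N :=
      fun _ _ => rfl
    rw [h1, h4, h5, h2, h3, ← hD]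
    abel
  have hDD : ‖D‖ ^ 2 = inner ℝ D F := by
    rw [← real_inner_self_eq_norm_sq, inner_eq_trace 0, inner_eq_trace 0, hD, unfold_fold]
    exact trace_tangentProj_transpose_mul hU hV _
  -- `X` shares its column factor `U` with one part of `D`, so the two merge and the rank is at most
  -- `3ρ` rather than `4ρ`.
  have hrank : ∀ s t : ℝ, (unfold 0 (s • D + t • -G)).rank ≤ 3 * ρ := by
    intro s t
    have : unfold 0 (s • D + t • -G) =
        U * (s • (Uᵀ * unfold 0 F) - t • N) +
          (s • ((unfold 0 F - U * (Uᵀ * unfold 0 F)) * V)) * Vᵀ + t • unfold 0 T := by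
      have h1 : unfold 0 (s • D + t • -G) =
          s • tangentProj U V (unfold 0 F) + t • (unfold 0 T - U * N) := by
        rw [← hX, ← unfold_sub, hG, neg_sub, unfold_add, unfold_smul, unfold_smul, hD, unfold_fold]
      rw [h1, tangentProj_eq_mul_add_mul]
      simp only [smul_add, smul_sub, Matrix.mul_sub, Matrix.mul_smul, Matrix.smul_mul]
      abel
    rw [this]
    exact (rank_mul_add_mul_le _ _ _ _ _ _).trans (by omega)
  have h1 := h.inner_sub_inner_le D (-G) hrank
  rw [map_neg, inner_neg_right, inner_neg_right, norm_neg] at h1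
  rw [hF, inner_sub_right, LinearMap.adjoint_inner_right] at hDD
  have h2 : ‖D‖ ≤ R * ‖G‖ := by
    rcases (norm_nonneg D).eq_or_lt with h0 | h0
    · rw [← h0]
      positivity
    · refine le_of_mul_le_mul_left ?_ h0
      nlinarith
  rw [hsplit]
  exact (norm_sub_le _ _).trans (by linarith)

end RestrictedIsometry

/-! ### Condition number -/

section Condition

lemma rank_pos_of_ne_zero {a b : Type*} [Fintype a] [Fintype b] {M : Matrix a b ℝ} (hM : M ≠ 0) :
    0 < M.rank := by
  classical
  refine Nat.pos_of_ne_zero fun h0 => hM ?_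
  obtain ⟨U, V, h⟩ := exists_isSVD M
  rw [h.eq]
  have : IsEmpty (Fin M.rank) := by rw [h0]; infer_instance
  ext i j
  simp [mul_apply]

variable {d : ℕ} [NeZero d] {n : Fin d → ℕ}

lemma unfold_ne_zero {T : Tensor n} (hT : T ≠ 0) : unfold 0 T ≠ 0 := by
  intro h
  have := norm_sq_eq_frobSq 0 T
  rw [h] at this
  simp [frobSq] at this
  exact hT this

lemma singularValue_rank_pos {T : Tensor n} (hT : T ≠ 0) :
    0 < singularValue (unfold 0 T) (unfold 0 T).rank := by
  have h := rank_pos_of_ne_zero (unfold_ne_zero hT)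
  obtain ⟨q, hq⟩ := Nat.exists_eq_succ_of_ne_zero h.ne'
  conv => rhs; arg 2; rw [hq]
  rw [Nat.succ_eq_add_one, singularValue_succ_pos_iff]
  omega

lemma kappa₁_pos {T : Tensor n} (hT : T ≠ 0) : 0 < kappa₁ T (unfold 0 T).rank := by
  have h := rank_pos_of_ne_zero (unfold_ne_zero hT)
  exact div_pos ((singularValue_rank_pos hT).trans_le (singularValue_antitone _ h))
    (singularValue_rank_pos hT)

/-- The squared norm is a sum of `rank` squared singular values, each at most the largest. This
turns `‖T‖ / s` into the factor `√r κ₁` of the rate. -/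
lemma norm_le_sqrt_rank_mul_kappa₁ {T : Tensor n} (hT : T ≠ 0) :
    ‖T‖ ≤ √((unfold 0 T).rank : ℝ) * kappa₁ T (unfold 0 T).rank *
      singularValue (unfold 0 T) (unfold 0 T).rank := by
  rw [mul_assoc, kappa₁, div_mul_cancel₀ _ (singularValue_rank_pos hT).ne']
  refine le_of_sq_le_sq ?_ (mul_nonneg (Real.sqrt_nonneg _) (singularValue_nonneg _ _))
  obtain ⟨U, V, h⟩ := exists_isSVD (unfold 0 T)
  rw [norm_sq_eq_frobSq 0, h.frobSq_eq, mul_pow, Real.sq_sqrt (Nat.cast_nonneg _)]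
  refine (Finset.sum_le_card_nsmul _ _ (singularValue (unfold 0 T) 1 ^ 2) fun i _ => ?_).trans ?_
  · exact pow_le_pow_left₀ (singularValue_nonneg _ _)
      (singularValue_antitone _ (Nat.le_add_left 1 _)) 2
  · simp

end Condition

/-! ### Rate and scalar recursion -/

section Rate

/-- The weak form of the condition on the restricted isometry constant implies a rate below `1`. -/
lemma gamma₁_lt_one {d ρ : ℕ} {κ R : ℝ} (hκ : 0 ≤ κ) (hR : 0 ≤ R)
    (h : R < min (1 / 2) (1 / ((20 * √((d : ℝ) - 1) + 24) * √(ρ : ℝ) * κ + √(d : ℝ) + 3))) :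
    gamma₁ d ρ κ R < 1 := by
  obtain ⟨h1, h2⟩ := lt_min_iff.mp h
  have hs := Real.sqrt_nonneg ((d : ℝ) - 1)
  have hc : 0 ≤ √(ρ : ℝ) * κ := mul_nonneg (Real.sqrt_nonneg _) hκ
  have hd := Real.sqrt_nonneg (d : ℝ)
  have hsc : 0 ≤ √((d : ℝ) - 1) * (√(ρ : ℝ) * κ) := mul_nonneg hs hc
  rw [lt_div_iff₀ (by nlinarith)] at h2
  refine lt_of_le_of_lt ?_ h2
  rw [gamma₁]
  refine mul_le_mul_of_nonneg_left ?_ hR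
  -- The value at `R = 1/2`; multiplied by 8 it gives `20 √(d-1) + 24`.
  have h3 : (√((d : ℝ) - 1) + 1) * (R + 2) + R ≤ 5 / 2 * √((d : ℝ) - 1) + 3 := by nlinarith
  have h4 := mul_le_mul_of_nonneg_left h3 hc
  linarith

/-- Linear convergence of a sequence of errors `e` whose growth is governed by a linear term and a
quadratic one. -/
lemma le_mul_pow_of_quadratic {e : ℕ → ℝ} {c₀ q L γ : ℝ} (hγ : γ ≤ 1)
    (hL : 0 ≤ L) (he : ∀ k, 0 ≤ e k) (h0 : e 0 ≤ c₀)
    (hstep : ∀ k, e (k + 1) ≤ q * e k + L * e k ^ 2) (hrate : q + L * c₀ ≤ γ) (hγ0 : 0 ≤ γ)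
    (k : ℕ) :
    e k ≤ c₀ * γ ^ k := by
  have hc : 0 ≤ c₀ := (he 0).trans h0
  induction k with
  | zero => simpa using h0
  | succ k ih =>
    have h1 : e k ≤ c₀ := ih.trans (mul_le_of_le_one_right hc (pow_le_one₀ hγ0 hγ))
    have h2 : L * e k ≤ L * c₀ := mul_le_mul_of_nonneg_left h1 hL
    have h3 := mul_le_mul_of_nonneg_right h2 (he k)
    have h4 := mul_le_mul_of_nonneg_right hrate (he k)
    have h5 := mul_le_mul_of_nonneg_left ih hγ0
    calc e (k + 1) ≤ γ * e k := by nlinarith [hstep k]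
      _ ≤ γ * (c₀ * γ ^ k) := h5
      _ = c₀ * γ ^ (k + 1) := by ring

end Rate

/-! ### Error bounds along a run -/

section Run

variable {d m : ℕ} [NeZero d] {n r : Fin d → ℕ} {A : Tensor n →ₗ[ℝ] EuclideanSpace ℝ (Fin m)}
  {T : Tensor n} {R : ℝ} {X Xhat W : ℕ → Tensor n}
  {U : ℕ → Matrix (Fin (n 0)) (Fin (r 0)) ℝ} {σ : ℕ → Fin (r 0) → ℝ}
  {V : ℕ → Matrix (RestIdx n 0) (Fin (r 0)) ℝ} {α : ℕ → ℝ}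

lemma IsRun.norm_sub_le_W (h : IsRun A T r α X Xhat W U σ V) (hT : HasMultilinearRank T r)
    (k : ℕ) : ‖X k - T‖ ≤ (√(d : ℝ) + 1) * ‖W k - T‖ := by
  have hst : IsSTHOSVD r (0 :: (List.finRange d).tail) n (W k) (X k) :=
    ⟨U k, σ k, V k, h.st_hosvd k⟩
  have h1 := hst.norm_sub_sq_le T fun j _ => (hT j).le
  have hlen : (0 :: (List.finRange d).tail).length = d := by
    have := NeZero.pos d
    simp only [List.length_cons, List.length_tail, List.length_finRange]
    omega
  rw [hlen] at h1
  have h2 : ‖X k - W k‖ ≤ √(d : ℝ) * ‖W k - T‖ := by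
    refine le_of_sq_le_sq ?_ (by positivity)
    rwa [mul_pow, Real.sq_sqrt (Nat.cast_nonneg _)]
  have h3 := norm_sub_le_norm_sub_add_norm_sub (X k) (W k) T
  linarith

lemma IsRun.unfold_Xhat (h : IsRun A T r α X Xhat W U σ V) (k : ℕ) :
    unfold 0 (Xhat k) = U k * ((U k)ᵀ * unfold 0 (W k)) := by
  rw [h.truncation, unfold_fold, (h.st_hosvd k).1.transpose_mul, Matrix.mul_assoc]

lemma IsRun.transpose_mul_unfold_Xhat (h : IsRun A T r α X Xhat W U σ V) (k : ℕ) :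
    (U k)ᵀ * unfold 0 (Xhat k) = (U k)ᵀ * unfold 0 (W k) := by
  rw [h.unfold_Xhat, ← Matrix.mul_assoc, (h.st_hosvd k).1.left_orthonormal, Matrix.one_mul]

lemma IsRun.norm_Xhat_sub_W_le (h : IsRun A T r α X Xhat W U σ V) (hT : HasMultilinearRank T r)
    (k : ℕ) : ‖Xhat k - W k‖ ≤ ‖T - W k‖ := by
  refine le_of_sq_le_sq ?_ (norm_nonneg _)
  rw [norm_sub_rev, norm_sub_rev T, norm_sq_eq_frobSq 0, norm_sq_eq_frobSq 0, unfold_sub,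
    unfold_sub, h.unfold_Xhat]
  exact (h.st_hosvd k).1.eckart_young _ (hT 0).le

lemma IsRun.norm_Xhat_sub_le (h : IsRun A T r α X Xhat W U σ V) (hT : HasMultilinearRank T r)
    (k : ℕ) : ‖Xhat k - T‖ ≤ 2 * ‖W k - T‖ := by
  have h1 := h.norm_Xhat_sub_W_le hT k
  have h2 := norm_sub_le_norm_sub_add_norm_sub (Xhat k) (W k) T
  rw [norm_sub_rev T] at h1
  linarith

/-- `Xhat k` and `W k` have the same compression by `(U k)ᵀ`, so relative to `Xhat k` only the
remaining `d - 1` modes contribute error. -/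
lemma IsRun.norm_sub_le_Xhat (h : IsRun A T r α X Xhat W U σ V) (hT : HasMultilinearRank T r)
    (k : ℕ) : ‖X k - T‖ ≤ (√((d : ℝ) - 1) + 1) * ‖Xhat k - T‖ := by
  have hU := (h.st_hosvd k).1.left_orthonormal
  obtain ⟨Y, hY, hX, -⟩ := (h.st_hosvd k).exists_norm_sub_sq
  have h1 := hY.norm_sub_sq_le (foldUpdate 0 ((U k)ᵀ * unfold 0 T)) fun j _ =>
    (rank_unfold_foldUpdate_mul_le j 0 _ T).trans (hT j).le
  have h2 := norm_foldUpdate_sub_sq_le (k := 0) hU (Xhat k) T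
  rw [h.transpose_mul_unfold_Xhat] at h2
  have h3 : ‖X k - Xhat k‖ ^ 2 = ‖Y - foldUpdate 0 ((U k)ᵀ * unfold 0 (W k))‖ ^ 2 := by
    rw [norm_sq_eq_frobSq 0 (X k - Xhat k), norm_sq_eq_frobSq_unfoldUpdate, unfold_sub, hX,
      unfold_modeProduct, h.unfold_Xhat, ← Matrix.mul_sub, frobSq_orthonormal_mul hU,
      unfoldUpdate_sub, unfoldUpdate_foldUpdate]
  have hlen : ((List.finRange d).tail.length : ℝ) = (d : ℝ) - 1 := by
    rw [List.length_tail, List.length_finRange, Nat.cast_sub (NeZero.pos d), Nat.cast_one]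
  have hd : 0 ≤ (d : ℝ) - 1 := hlen ▸ Nat.cast_nonneg _
  rw [hlen, ← h3] at h1
  have h4 : ‖X k - Xhat k‖ ≤ √((d : ℝ) - 1) * ‖Xhat k - T‖ := by
    refine le_of_sq_le_sq ?_ (by positivity)
    rw [mul_pow, Real.sq_sqrt hd]
    exact h1.trans (mul_le_mul_of_nonneg_left h2 hd)
  have h5 := norm_sub_le_norm_sub_add_norm_sub (X k) (Xhat k) T
  linarith

/-- Restricted isometry does not bound `W 0 - T` directly, since `A*A T` may have large rank. Its
truncation is controlled, because `Xhat 0 - T` has first-mode rank at most `2 r 0`. -/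
lemma IsRun.norm_Xhat_zero_sub_le (h : IsRun A T r α X Xhat W U σ V)
    (hT : HasMultilinearRank T r) (hR : FirstModeRIP A (3 * r 0) R) (hR0 : 0 ≤ R) :
    ‖Xhat 0 - T‖ ≤ 2 * R * ‖T‖ := by
  have h1 := h.norm_Xhat_sub_W_le hT 0
  rw [h.init] at h1
  have h2 := hR.norm_sub_le_of_isBest T (Xhat 0) h1 fun s t => by
    have : unfold 0 (s • (Xhat 0 - T) + t • T) =
        U 0 * (s • ((U 0)ᵀ * unfold 0 (W 0))) + (t - s) • unfold 0 T := by
      rw [unfold_add, unfold_smul, unfold_smul, unfold_sub, h.unfold_Xhat, Matrix.mul_smul,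
        smul_sub, sub_smul]
      abel
    rw [this]
    exact (rank_mul_add_smul_le _ _ _ _).trans (by rw [hT 0]; omega)
  rcases (norm_nonneg (Xhat 0 - T)).eq_or_lt with h0 | h0
  · rw [← h0]
    positivity
  · refine le_of_mul_le_mul_left ?_ h0
    linarith

/-- The component of `T` normal to the tangent space used in step `k`. -/
lemma IsRun.norm_normal_le (h : IsRun A T r α X Xhat W U σ V) (k : ℕ) :
    ‖fold 0 (unfold 0 T - tangentProj (U k) (V k) (unfold 0 T))‖ ≤ ‖Xhat k - T‖ ∧
      singularValue (unfold 0 T) (unfold 0 T).rank *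
        ‖fold 0 (unfold 0 T - tangentProj (U k) (V k) (unfold 0 T))‖ ≤ ‖Xhat k - T‖ ^ 2 := by
  have hsvd := (h.st_hosvd k).1
  have hU := hsvd.left_orthonormal
  have hV := hsvd.right_orthonormal
  have hM : U k * ((U k)ᵀ * unfold 0 (Xhat k)) = unfold 0 (Xhat k) := by
    rw [h.transpose_mul_unfold_Xhat, h.unfold_Xhat]
  have hM' : unfold 0 (Xhat k) * (V k * (V k)ᵀ) = unfold 0 (Xhat k) := by
    rw [h.truncation, unfold_fold, Matrix.mul_assoc, ← Matrix.mul_assoc (V k)ᵀ, hV,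
      Matrix.one_mul]
  constructor
  · refine le_of_sq_le_sq ?_ (norm_nonneg _)
    rw [norm_sq_eq_frobSq 0, norm_sq_eq_frobSq 0, unfold_fold, unfold_sub]
    exact frobSq_sub_tangentProj_le hU hV _ hM
  · refine le_of_sq_le_sq ?_ (sq_nonneg _)
    rw [mul_pow, norm_sq_eq_frobSq 0, norm_sq_eq_frobSq 0, unfold_fold, unfold_sub]
    exact sq_mul_frobSq_sub_tangentProj_le hU hV _ hM hM'

lemma IsRun.norm_W_succ_sub_le (h : IsRun A T r (fun _ => 1) X Xhat W U σ V)
    (hT : HasMultilinearRank T r) (hR : FirstModeRIP A (3 * r 0) R) (hR0 : 0 ≤ R) (k : ℕ) :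
    ‖W (k + 1) - T‖ ≤ R * ‖X k - T‖ +
      ‖fold 0 (unfold 0 T - tangentProj (U k) (V k) (unfold 0 T))‖ := by
  have hsvd := (h.st_hosvd k).1
  obtain ⟨Y, -, hX⟩ := (h.st_hosvd k).2
  rw [h.step, one_smul]
  refine hR.norm_fold_tangentProj_sub_le (hT 0).le hR0 hsvd.left_orthonormal
    hsvd.right_orthonormal (N := unfoldUpdate 0 Y) ?_
  rw [hX, unfold_modeProduct]

/-- Linear convergence of the auxiliary iterates. -/
theorem IsRun.norm_W_succ_sub_le_pow (h : IsRun A T r (fun _ => 1) X Xhat W U σ V) (hT0 : T ≠ 0)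
    (hT : HasMultilinearRank T r) (hR : FirstModeRIP A (3 * r 0) R) (hR0 : 0 ≤ R)
    (hγ : gamma₁ d (r 0) (kappa₁ T (r 0)) R < 1) (k : ℕ) :
    ‖W (k + 1) - T‖ ≤ (5 / 2 * √((d : ℝ) - 1) + 3) * ‖T‖ *
      gamma₁ d (r 0) (kappa₁ T (r 0)) R ^ k := by
  have hs := singularValue_rank_pos hT0
  have hn := norm_le_sqrt_rank_mul_kappa₁ hT0
  have hκ := kappa₁_pos hT0
  have hnormal := h.norm_normal_le
  rw [hT 0] at hs hn hκ hnormal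
  set γ := gamma₁ d (r 0) (kappa₁ T (r 0)) R with hγdef
  set κ := kappa₁ T (r 0)
  set s := singularValue (unfold 0 T) (r 0)
  set p := √((d : ℝ) - 1) with hp
  set c := R * ((p + 1) * (R + 2) + R) with hc
  have hp0 : 0 ≤ p := Real.sqrt_nonneg _
  have hd1 : 1 ≤ √(d : ℝ) := Real.one_le_sqrt.mpr (by exact_mod_cast NeZero.pos d)
  have hT1 : 0 < ‖T‖ := norm_pos_iff.mpr hT0
  have hg0 : 0 ≤ √(r 0 : ℝ) * κ := by positivity
  have hc0 : 0 ≤ c := by positivity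
  have hγeq : γ = 8 * (√(r 0 : ℝ) * κ) * c + R * (√(d : ℝ) + 3) := by
    rw [hγdef, gamma₁, hc]
    ring
  have hγ0 : 0 ≤ γ := by rw [hγeq]; positivity
  -- From `4 R ≤ R (√d + 3) ≤ γ < 1`, using `√d ≥ 1`.
  have hR4 : R ≤ 1 / 4 := by
    have : 0 ≤ 8 * (√(r 0 : ℝ) * κ) * c := by positivity
    nlinarith
  -- Here the linear bound on the normal component is used: with `‖Xhat 0 - T‖ ≤ 2R ‖T‖` it already
  -- makes the error `O(R)`, without a condition number.
  have hfirst : ‖W 1 - T‖ ≤ c * ‖T‖ := by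
    have h1 := h.norm_W_succ_sub_le hT hR hR0 0
    have h2 := (hnormal 0).1
    have h3 := h.norm_sub_le_Xhat hT 0
    have h4 := h.norm_Xhat_zero_sub_le hT hR hR0
    have h5 : ‖W 1 - T‖ ≤ (R * (p + 1) + 1) * (2 * R * ‖T‖) := by
      have h6 := mul_le_mul_of_nonneg_left h3 hR0
      have h7 := mul_le_mul_of_nonneg_left h4 (show 0 ≤ R * (p + 1) + 1 by positivity)
      linarith
    refine h5.trans ?_
    have h8 : (R * (p + 1) + 1) * (2 * R) ≤ c := by
      have : 0 ≤ R * p * (2 - R) := by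
        have : 0 ≤ 2 - R := by linarith
        positivity
      rw [hc]
      linarith
    have := mul_le_mul_of_nonneg_right h8 hT1.le
    linarith
  have hstep : ∀ k, ‖W (k + 1 + 1) - T‖ ≤
      R * (√(d : ℝ) + 1) * ‖W (k + 1) - T‖ + 4 / s * ‖W (k + 1) - T‖ ^ 2 := by
    intro k
    have h1 := h.norm_W_succ_sub_le hT hR hR0 (k + 1)
    have h2 := (hnormal (k + 1)).2
    have h3 := mul_le_mul_of_nonneg_left (h.norm_sub_le_W hT (k + 1)) hR0
    have h4 := pow_le_pow_left₀ (norm_nonneg _) (h.norm_Xhat_sub_le hT (k + 1)) 2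
    have h5 : ‖fold 0 (unfold 0 T - tangentProj (U (k + 1)) (V (k + 1)) (unfold 0 T))‖ ≤
        4 / s * ‖W (k + 1) - T‖ ^ 2 := by
      rw [div_mul_eq_mul_div, le_div_iff₀ hs]
      linarith
    linarith
  -- There is slack: 4 suffices where `γ` has 8, and `√d + 1` where it has `√d + 3`.
  have hrate : R * (√(d : ℝ) + 1) + 4 / s * (c * ‖T‖) ≤ γ := by
    have h1 : 4 / s * (c * ‖T‖) ≤ 4 * (√(r 0 : ℝ) * κ) * c := by
      rw [div_mul_eq_mul_div, div_le_iff₀ hs]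
      have := mul_le_mul_of_nonneg_left hn hc0
      linarith
    have h2 : 0 ≤ √(r 0 : ℝ) * κ * c := by positivity
    rw [hγeq]
    linarith
  -- The recursion starts at `W 1`, hence the power `γ ^ k` at index `k + 1`.
  have hmain := le_mul_pow_of_quadratic (e := fun k => ‖W (k + 1) - T‖) hγ.le (by positivity)
    (fun _ => norm_nonneg _) hfirst hstep hrate hγ0 k
  have hc3 : c ≤ 5 / 2 * p + 3 := by
    have h1 : (p + 1) * (R + 2) + R ≤ 5 / 2 * p + 3 := by nlinarith
    have h2 : 0 ≤ (p + 1) * (R + 2) + R := by positivity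
    rw [hc]
    nlinarith
  refine hmain.trans ?_
  gcongr

end Run

end SMQRGD

theorem theorem1 {d m : ℕ} [NeZero d] (n r : Fin d → ℕ)
    (A : SMQRGD.Tensor n →ₗ[ℝ] EuclideanSpace ℝ (Fin m)) (T : SMQRGD.Tensor n) (hT : T ≠ 0)
    (hr : SMQRGD.HasMultilinearRank T r)
    (R : ℝ) (hR : SMQRGD.FirstModeRIP A (3 * r 0) R) :
    (R < min (1 / 2) (1 / ((20 * √((d : ℝ) - 1) + 24) * √(r 0 : ℝ) * SMQRGD.kappa₁ T (r 0)
        + √(d : ℝ) + 3)) →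
      SMQRGD.gamma₁ d (r 0) (SMQRGD.kappa₁ T (r 0)) R < 1) ∧
    (SMQRGD.gamma₁ d (r 0) (SMQRGD.kappa₁ T (r 0)) R < 1 →
      ∀ (X Xhat W : ℕ → SMQRGD.Tensor n)
        (U : ℕ → Matrix (Fin (n 0)) (Fin (r 0)) ℝ) (σ : ℕ → Fin (r 0) → ℝ)
        (V : ℕ → Matrix (SMQRGD.RestIdx n 0) (Fin (r 0)) ℝ),
        SMQRGD.IsRun A T r (fun _ => 1) X Xhat W U σ V →
        ∀ k : ℕ, ‖X (k + 1) - T‖ ≤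
          (√(d : ℝ) + 1) * (5 / 2 * √((d : ℝ) - 1) + 3)
            * SMQRGD.gamma₁ d (r 0) (SMQRGD.kappa₁ T (r 0)) R ^ k * ‖T‖) := by
  have hR0 : 0 ≤ R := hR.const_nonneg hT (by rw [hr 0]; omega)
  have hκ : 0 ≤ SMQRGD.kappa₁ T (r 0) := by
    rw [← hr 0]
    exact (SMQRGD.kappa₁_pos hT).le
  refine ⟨SMQRGD.gamma₁_lt_one hκ hR0, fun hγ X Xhat W U σ V h k => ?_⟩
  refine (h.norm_sub_le_W hr (k + 1)).trans ?_
  refine (mul_le_mul_of_nonneg_left (h.norm_W_succ_sub_le_pow hT hr hR hR0 hγ k)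
    (by positivity)).trans_eq ?_
  ring
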